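/- Let $\alpha>0$, $\sigma_0>0$, and let $X=\{X(k)\}_{k\in\mathbb Z}$ be a strictly stationary sequence of real random variables with heavy-tailed marginal distributions, $\mathbb P\{X(k)>x\}\sim\sigma_0^{\alpha}x^{-\alpha}$ as $x\to\infty$. For $m,k\ge 1$ let $X_m(k):=\max_{1\le i\le m}X(m(k-1)+i)$, and suppose that, as $m\to\infty$, the finite-dimensional distributions of $\{m^{-1/\alpha}X_m(k)\}_{k\ge1}$ converge weakly to those of a sequence $Z=\{Z(k)\}_{k\ge1}$ of real random variables, which are not assumed to be independent. Suppose that $Z$ is multivariate max-stable, i.e. for every finite set $I$ of indices and every $n\ge1$ there are constants $a_k>0$ and $b_k\in\mathbb R$ ($k\in I$) such that, if $Z^{(1)},\dots,Z^{(n)}$ are independent copies of the vector $(Z(k))_{k\in I}$, the vector $\big(\max_{1\le j\le n}Z^{(j)}(k)\big)_{k\in I}$ has the same law as $(a_kZ(k)+b_k)_{k\in I}$. Then the random variables $Z(k)$, $k\ge1$, are independent and identically distributed. Moreover, either $Z(k)=0$ almost surely for all $k$ (the degenerate case), or there is $\sigma>0$ such that every $Z(k)$ is $\alpha$-Fréchet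 with scale coefficient $\sigma$, i.e. $\mathbb P\{Z(k)\le x\}=\exp\{-\sigma^{\alpha}x^{-\alpha}\}$ for $x>0$ and $=0$ for $x\le0$. -/

import Mathlib

open MeasureTheory ProbabilityTheory Filter Asymptotics

/-- The time series `X = {X(k)}_{k ∈ ℤ}` is strictly stationary: its finite-dimensional
distributions are invariant under shifts of time. -/
def IsStrictlyStationary {Ω : Type*} [MeasurableSpace Ω] (X : ℤ → Ω → ℝ) (P : Measure Ω) : Prop :=
  ∀ (I : Finset ℤ) (h : ℤ),
    IdentDistrib (fun ω (i : I) => X ((i : ℤ) + h) ω) (fun ω (i : I) => X (i : ℤ) ω) P P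

/-- `Y` is (right) heavy-tailed with index `α`, with asymptotically constant slowly varying
factor: `P(Y > x) ∼ σ₀ ^ α * x ^ (-α)` as `x → ∞`. -/
def IsHeavyTailed {Ω : Type*} [MeasurableSpace Ω] (α σ₀ : ℝ) (Y : Ω → ℝ) (P : Measure Ω) : Prop :=
  (fun x : ℝ => P.real {ω | x < Y ω}) ~[atTop] (fun x : ℝ => σ₀ ^ α * x ^ (-α))

/-- The maximum of `X` over the block of length `m` at location `k`. Locations are counted from
`0`, so that for `m ≥ 1` this is `max (X (m k + 1), …, X (m k + m))`. -/
noncomputable def blockMax {Ω : Type*} (X : ℤ → Ω → ℝ) (m k : ℕ) (ω : Ω) : ℝ :=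
  ⨆ i : Fin m, X ((m : ℤ) * (k : ℤ) + ((i : ℕ) : ℤ) + 1) ω

/-- Convergence of the finite-dimensional distributions of a sequence of discrete-time
processes `Y m` (on one probability space) to those of the process `Z`. -/
def TendstoFDD {Ω Ω' : Type*} [MeasurableSpace Ω] [MeasurableSpace Ω']
    (Y : ℕ → ℕ → Ω → ℝ) (Z : ℕ → Ω' → ℝ) (P : Measure Ω) [IsProbabilityMeasure P]
    (Q : Measure Ω') [IsProbabilityMeasure Q] : Prop :=
  ∀ I : Finset ℕ,
    TendstoInDistribution (fun (m : ℕ) ω (k : I) => Y m (k : ℕ) ω) atTop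
      (fun ω (k : I) => Z (k : ℕ) ω) (fun _ => P) Q

/-- A law on `ℝ^ι` is (multivariate) max-stable: for every `n ≥ 1` the coordinatewise maximum of
`n` independent vectors with this law has the law of `a z + b` (coordinatewise), for some
`a i > 0` and `b i`. Degenerate marginals are allowed. -/
def IsMaxStableLaw {ι : Type*} [Fintype ι] (ν : Measure (ι → ℝ)) : Prop :=
  ∀ n : ℕ, 1 ≤ n → ∃ a b : ι → ℝ, (∀ i, 0 < a i) ∧
    (Measure.pi (fun _ : Fin n => ν)).map (fun y i => ⨆ j : Fin n, y j i) =
      ν.map (fun z i => a i * z i + b i)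

/-- The time series `Z` is multivariate max-stable: so are its finite-dimensional laws. -/
def IsMaxStableProcess {Ω : Type*} [MeasurableSpace Ω] (Z : ℕ → Ω → ℝ) (Q : Measure Ω) : Prop :=
  ∀ I : Finset ℕ, IsMaxStableLaw (Q.map (fun ω (k : I) => Z (k : ℕ) ω))

/-- `Y` is `α`-Fréchet with scale coefficient `σ`. -/
def IsFrechet {Ω : Type*} [MeasurableSpace Ω] (α σ : ℝ) (Y : Ω → ℝ) (Q : Measure Ω) : Prop :=
  ∀ x : ℝ, Q.real {ω | Y ω ≤ x} = if 0 < x then Real.exp (-(σ ^ α * x ^ (-α))) else 0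

/-!
The limit `Z` inherits three facts from the block maxima: it is nonnegative, its marginal
distribution function `F` satisfies the tail bound `1 - F x ≤ σ₀ ^ α * x ^ (-α)`, and the maximum
of `Z` over `n` consecutive times has the law of `n ^ (1 / α) * Z 0`, since `n` blocks of length
`m` make one block of length `n * m` (`measureReal_forall_le_of_tendstoFDD_blockMax`).

Max-stability makes the joint distribution function `G` infinitely divisible for maxima: for each
`n`, `G ^ (1 / n)` is the distribution function of an affine image of the vector. Applying
elementary inclusion bounds to these roots and letting `n → ∞` turns probabilities into
logarithms, and gives `G ≥ ∏ F` (`IsMaxStableLaw.prod_le`) and the monotonicity of `G / ∏ F`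
(`IsMaxStableLaw.mul_prod_le_mul_prod`). With self-similarity the first inequality reads
`F (n ^ (1 / α) * x) ^ n ≤ F x`.

If `F` reaches `1`, this inequality forces `Z = 0`. Otherwise let `l` be the left endpoint of the
support of `F`. The norming maps fix `l`, hence are dilations about `l`; the tail bound shows that
their factors are at most `n ^ (1 / α)`, the inequality above that they are at least that, and then
that `l = 0` (`scaling_of_norming`). In both cases `F (n ^ (1 / α) * x) ^ n = F x`, which says
that `G` equals `∏ F` on the diagonal. Since `G / ∏ F` decreases and is at least `1`, the two agree
everywhere (`IsMaxStableLaw.eq_prod_of_diagonal`), which is independence; and in the nondegenerate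
case the scaling relation has only the Fréchet solutions (`eq_frechet_of_scaling`).
-/

open scoped Topology

/-! ### Distribution functions with max-stable scaling -/

/-- Iterating the relation gives `f 1 = f (a ^ k) ^ (n ^ k) ≥ 1 - C * (n * a ^ (-α)) ^ k` by
Bernoulli's inequality; the right side would tend to `1` if `a` exceeded `n ^ (1 / α)`. -/
theorem norming_le_of_tail {α C : ℝ} {n : ℕ} {a : ℝ} {f : ℝ → ℝ} (hα : 0 < α) (hn : 2 ≤ n)
    (ha : 0 < a) (hf1 : f 1 < 1) (hf0 : ∀ u, 0 ≤ f u)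
    (htail : ∀ u, 0 < u → 1 - f u ≤ C * u ^ (-α))
    (hscale : ∀ u, f (a * u) ^ n = f u) : a ≤ (n : ℝ) ^ (1 / α) := by
  by_contra! hlt
  have hn0 : (0 : ℝ) < n := by positivity
  have hq : (n : ℝ) * a ^ (-α) < 1 := by
    have h1 : (n : ℝ) < a ^ α := by
      have := Real.rpow_lt_rpow (by positivity) hlt hα
      rwa [← Real.rpow_mul hn0.le, one_div_mul_cancel hα.ne', Real.rpow_one] at this
    rw [Real.rpow_neg ha.le, ← div_eq_mul_inv, div_lt_one (by positivity)]
    exact h1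
  have hiter : ∀ k : ℕ, f (a ^ k) ^ (n ^ k) = f 1 := by
    intro k
    induction k with
    | zero => simp
    | succ k ih => rw [pow_succ' a, pow_succ' n, pow_mul, hscale, ih]
  have hbound : ∀ k : ℕ, 1 - C * ((n : ℝ) * a ^ (-α)) ^ k ≤ f 1 := by
    intro k
    have hB := one_add_mul_le_pow (a := f (a ^ k) - 1) (by linarith [hf0 (a ^ k)]) (n ^ k)
    rw [add_sub_cancel, hiter k] at hB
    have hT := htail (a ^ k) (by positivity)
    have hpow : (a ^ k) ^ (-α) = (a ^ (-α)) ^ k := by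
      rw [← Real.rpow_natCast, ← Real.rpow_natCast, ← Real.rpow_mul ha.le, ← Real.rpow_mul ha.le,
        mul_comm]
    rw [hpow] at hT
    push_cast at hB
    have := mul_le_mul_of_nonneg_left hT (pow_nonneg hn0.le k)
    rw [mul_pow]
    linarith
  have hlim : Tendsto (fun k : ℕ => 1 - C * ((n : ℝ) * a ^ (-α)) ^ k) atTop (𝓝 (1 - C * 0)) :=
    ((tendsto_pow_atTop_nhds_zero_of_lt_one (by positivity) hq).const_mul C).const_sub 1
  have := le_of_tendsto' hlim hbound
  linarith

/-- A max-stable distribution function on `[0, ∞)` with unbounded support has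
the norming maps `x ↦ n ^ (1 / α) * x`, as soon as it has an `α`-tail bound and satisfies
`hassoc`. No classification of the extreme value laws is needed. -/
theorem scaling_of_norming {α C : ℝ} {F : ℝ → ℝ} (hα : 0 < α) (hmono : Monotone F)
    (h0 : ∀ x, 0 ≤ F x) (hlim : Tendsto F atTop (𝓝 1)) (hneg : ∀ x < 0, F x = 0)
    (hlt : ∀ x, F x < 1) (htail : ∀ x, 0 < x → 1 - F x ≤ C * x ^ (-α))
    (hassoc : ∀ n : ℕ, 1 ≤ n → ∀ x, F ((n : ℝ) ^ (1 / α) * x) ^ n ≤ F x)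
    (hms : ∀ n : ℕ, 1 ≤ n → ∃ a b : ℝ, 0 < a ∧ ∀ x, F (a * x + b) ^ n = F x)
    (n : ℕ) (hn : 1 ≤ n) (x : ℝ) : F ((n : ℝ) ^ (1 / α) * x) ^ n = F x := by
  set S : Set ℝ := {x | 0 < F x} with hS
  have hSne : S.Nonempty := by
    obtain ⟨y, hy⟩ := (hlim.eventually (lt_mem_nhds one_pos)).exists
    exact ⟨y, hy⟩
  have hSb : ∀ y ∈ S, 0 ≤ y := fun y hy => by
    by_contra! h
    exact hy.ne' (hneg y h)
  have hSbdd : BddBelow S := ⟨0, hSb⟩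
  set l : ℝ := sInf S with hl
  have hl0 : 0 ≤ l := le_csInf hSne hSb
  have hpos : ∀ u, 0 < u → 0 < F (l + u) := fun u hu => by
    obtain ⟨y, hy, hyu⟩ := exists_lt_of_csInf_lt hSne (show sInf S < l + u by linarith)
    exact lt_of_lt_of_le hy (hmono hyu.le)
  have hmem : ∀ y, 0 < F y → l ≤ y := fun y hy => csInf_le hSbdd hy
  -- the norming maps fix the left endpoint of the support
  have hcenter : ∀ n : ℕ, 1 ≤ n → ∃ a : ℝ, 0 < a ∧ ∀ u, F (l + a * u) ^ n = F (l + u) := by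
    intro n hn
    obtain ⟨a, b, ha, hab⟩ := hms n hn
    have hge : l ≤ a * l + b := by
      refine le_of_forall_pos_le_add fun ε hε => ?_
      have h1 : 0 < F (a * (l + ε / a) + b) ^ n := by
        rw [hab]; exact hpos _ (by positivity)
      have h2 : 0 < F (a * (l + ε / a) + b) :=
        lt_of_le_of_ne (h0 _) fun h => by
          rw [← h, zero_pow (by omega)] at h1; exact lt_irrefl _ h1
      have := hmem _ h2
      have e : a * (l + ε / a) + b = a * l + b + ε := by field_simp; ring
      linarith
    have hle : a * l + b ≤ l := by
      by_contra! h
      set δ := (a * l + b - l) with hδ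
      have hδ0 : 0 < δ := by linarith
      have h1 : 0 < F (a * (l - δ / (2 * a)) + b) := by
        have e : a * (l - δ / (2 * a)) + b = l + δ / 2 := by
          have : a * (l - δ / (2 * a)) = a * l - δ / 2 := by field_simp
          rw [this]; linarith
        rw [e]; exact hpos _ (by positivity)
      have h2 : 0 < F (l - δ / (2 * a)) := by rw [← hab]; positivity
      have := hmem _ h2
      have : 0 < δ / (2 * a) := by positivity
      linarith
    refine ⟨a, ha, fun u => ?_⟩
    rw [← hab (l + u)]
    congr 2
    linarith
  -- association, iterated, in coordinates centred at the left endpoint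
  have hc1 : ∀ n : ℕ, 2 ≤ n → 1 < (n : ℝ) ^ (1 / α) := fun n hn =>
    Real.one_lt_rpow (by exact_mod_cast hn) (by positivity)
  have hassoc' : ∀ n : ℕ, 2 ≤ n → ∀ a : ℝ, 0 < a → (∀ u, F (l + a * u) ^ n = F (l + u)) →
      ∀ u, 0 < u → ∀ k : ℕ,
        F (l + (((n : ℝ) ^ (1 / α)) ^ k * (l + u) - l) / a ^ k) ≤ F (l + u) := by
    intro n hn a ha hs u hu k
    have hit : ∀ v, F (l + a ^ k * v) ^ (n ^ k) = F (l + v) := by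
      clear hu
      induction k with
      | zero => simp
      | succ k ih =>
        intro v
        rw [pow_succ' a, pow_succ' n, pow_mul, mul_assoc, hs, ih]
    have := hassoc (n ^ k) (Nat.one_le_pow _ _ (by omega)) (l + u)
    rw [← hit]
    have e : l + a ^ k * ((((n : ℝ) ^ (1 / α)) ^ k * (l + u) - l) / a ^ k)
        = ((n ^ k : ℕ) : ℝ) ^ (1 / α) * (l + u) := by
      have hak : a ^ k ≠ 0 := by positivity
      push_cast
      rw [mul_div_cancel₀ _ hak, ← Real.rpow_natCast, ← Real.rpow_natCast,
        ← Real.rpow_mul (by positivity), ← Real.rpow_mul (by positivity), mul_comm (1 / α)]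
      ring
    rw [e]
    exact this
  have hnorm : ∀ n : ℕ, 2 ≤ n → ∀ u, F (l + (n : ℝ) ^ (1 / α) * u) ^ n = F (l + u) := by
    intro n hn
    obtain ⟨a, ha, hs⟩ := hcenter n (by omega)
    have hC : 0 ≤ C := by
      have := htail 1 one_pos
      rw [Real.one_rpow, mul_one] at this
      linarith [hlt 1]
    have hle : a ≤ (n : ℝ) ^ (1 / α) := by
      refine norming_le_of_tail (f := fun u => F (l + u)) (C := C) hα hn ha (hlt _)
        (fun u => h0 _) (fun u hu => ?_) hs
      refine (htail (l + u) (by linarith)).trans ?_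
      exact mul_le_mul_of_nonneg_left
        (Real.rpow_le_rpow_of_nonpos hu (by linarith) (by linarith)) hC
    have hge : (n : ℝ) ^ (1 / α) ≤ a := by
      by_contra! hac
      set c := (n : ℝ) ^ (1 / α) with hc
      have hcpos : 0 < c := by linarith
      have hT : Tendsto (fun k : ℕ => l + (c ^ k * (l + 1) - l) / a ^ k) atTop atTop := by
        have hq : Tendsto (fun k : ℕ => (c / a) ^ k) atTop atTop :=
          tendsto_pow_atTop_atTop_of_one_lt ((one_lt_div ha).2 hac)
        refine tendsto_atTop_mono (fun k => ?_) hq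
        have h1 : 1 ≤ c ^ k := one_le_pow₀ (hc1 n hn).le
        have h2 : c ^ k ≤ c ^ k * (l + 1) - l := by nlinarith
        rw [div_pow]
        have := div_le_div_of_nonneg_right h2 (show 0 ≤ a ^ k by positivity)
        linarith
      have := le_of_tendsto' (hlim.comp hT) (fun k => hassoc' n hn a ha hs 1 one_pos k)
      exact absurd this (not_le.2 (hlt _))
    rw [← le_antisymm hle hge]
    exact hs
  have hlz : l = 0 := by
    by_contra hne
    have hlpos : 0 < l := lt_of_le_of_ne hl0 (Ne.symm hne)
    set c := ((2 : ℕ) : ℝ) ^ (1 / α) with hc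
    have hcc : 1 < c := hc1 2 le_rfl
    have hc0 : 0 < c := by linarith
    obtain ⟨k, hk⟩ := (tendsto_pow_atTop_atTop_of_one_lt hcc).eventually_ge_atTop 2 |>.exists
    -- a shift by `l / 2` does not increase `F`, so neither do its iterates
    have hshift : ∀ u, 0 < u → F (l + (u + l / 2)) ≤ F (l + u) := by
      intro u hu
      have hA : F (l + (c ^ k * (l + u) - l) / c ^ k) ≤ F (l + u) :=
        hassoc' 2 le_rfl c hc0 (hnorm 2 le_rfl) u hu k
      refine le_trans (hmono ?_) hA
      have hck : 0 < c ^ k := by positivity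
      rw [add_le_add_iff_left, le_div_iff₀ hck]
      nlinarith
    have hshift' : ∀ j : ℕ, F (l + (1 + j * (l / 2))) ≤ F (l + 1) := by
      intro j
      induction j with
      | zero => simp
      | succ j ih =>
        refine le_trans ?_ ih
        have := hshift (1 + j * (l / 2)) (by positivity)
        refine le_trans (le_of_eq ?_) this
        congr 2; push_cast; ring
    have hT : Tendsto (fun j : ℕ => l + (1 + (j : ℝ) * (l / 2))) atTop atTop :=
      tendsto_atTop_add_const_left _ _ (tendsto_atTop_add_const_left _ _
        (tendsto_natCast_atTop_atTop.atTop_mul_const (by positivity)))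
    exact absurd (le_of_tendsto' (hlim.comp hT) hshift') (not_le.2 (hlt _))
  rcases Nat.lt_or_ge n 2 with h | h
  · obtain rfl : n = 1 := by omega
    simp
  · simpa [hlz] using hnorm n h x

/-- The nondegenerate solutions of the scaling relation on `[0, ∞)` are the Fréchet laws. -/
theorem eq_frechet_of_scaling {α : ℝ} {F : ℝ → ℝ} (hα : 0 < α) (hmono : Monotone F)
    (hlim : Tendsto F atTop (𝓝 1)) (hneg : ∀ x < 0, F x = 0)
    (hlt : ∀ x, F x < 1)
    (hscale : ∀ n : ℕ, 1 ≤ n → ∀ x, F ((n : ℝ) ^ (1 / α) * x) ^ n = F x) :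
    ∃ σ : ℝ, 0 < σ ∧
      ∀ x, F x = if 0 < x then Real.exp (-(σ ^ α * x ^ (-α))) else 0 := by
  have hzero : F 0 = 0 := by
    have h := hscale 2 (by norm_num) 0
    rw [mul_zero] at h
    nlinarith [hlt 0]
  -- the time change `s = x ^ α` turns the scaling relation into `g (n * s) = g s / n`
  set H : ℝ → ℝ := fun s => F (s ^ (1 / α)) with hH
  have hHs : ∀ n : ℕ, 1 ≤ n → ∀ s, 0 < s → H (n * s) ^ n = H s := by
    intro n hn s hs
    simp only [hH]
    rw [Real.mul_rpow (by positivity) hs.le, hscale n hn]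
  have hHpos : ∀ s, 0 < s → 0 < H s := by
    intro s hs
    have hT : Tendsto (fun n : ℕ => H (n * s)) atTop (𝓝 1) :=
      hlim.comp ((tendsto_rpow_atTop (by positivity)).comp
        (tendsto_natCast_atTop_atTop.atTop_mul_const hs))
    obtain ⟨n, hn, hn1⟩ := ((hT.eventually (lt_mem_nhds one_pos)).and
      (eventually_ge_atTop 1)).exists
    rw [← hHs n hn1 s hs]
    positivity
  set g : ℝ → ℝ := fun s => -Real.log (H s) with hg
  have hgpos : ∀ s, 0 < s → 0 < g s := fun s hs => by
    have := Real.log_neg (hHpos s hs) (hlt _)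
    simp only [hg]; linarith
  have hgs : ∀ n : ℕ, 1 ≤ n → ∀ s, 0 < s → n * g (n * s) = g s := by
    intro n hn s hs
    simp only [hg]
    rw [← hHs n hn s hs, Real.log_pow]
    ring
  have hganti : ∀ s t, 0 < s → s ≤ t → g t ≤ g s := by
    intro s t hs hst
    simp only [hg, neg_le_neg_iff]
    exact Real.log_le_log (hHpos s hs) (hmono (Real.rpow_le_rpow hs.le hst (by positivity)))
  have hrat : ∀ m n : ℕ, 1 ≤ m → 1 ≤ n → m * g (m / n) = n * g 1 := by
    intro m n hm hn
    have hm0 : (0 : ℝ) < m := by exact_mod_cast hm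
    have hn0 : (0 : ℝ) < n := by exact_mod_cast hn
    have h1 := hgs n hn (m / n) (by positivity)
    rw [mul_div_cancel₀ _ hn0.ne'] at h1
    have h2 := hgs m hm 1 one_pos
    rw [mul_one] at h2
    rw [← h1, ← h2]; ring
  have hgone : ∀ s, 0 < s → s * g s = g 1 := by
    intro s hs
    have hgsp := hgpos s hs
    have key : ∀ n : ℕ, 1 ≤ n * s → |g 1 - s * g s| * n ≤ g s := by
      intro n hns
      have hn : 1 ≤ n := by
        by_contra! h
        obtain rfl : n = 0 := by omega
        norm_num at hns
      have hn0 : (0 : ℝ) < n := by exact_mod_cast hn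
      have hm1 : 1 ≤ ⌊(n : ℝ) * s⌋₊ := Nat.le_floor (by exact_mod_cast hns)
      have hfl := Nat.floor_le (show 0 ≤ (n : ℝ) * s by positivity)
      have hfu := Nat.lt_floor_add_one ((n : ℝ) * s)
      set m := ⌊(n : ℝ) * s⌋₊
      have hm0 : (0 : ℝ) < m := by exact_mod_cast hm1
      have h1 := hrat m n hm1 hn
      have h2 := hrat (m + 1) n (by omega) hn
      push_cast at h2
      have h3 := hganti (m / n) s (by positivity) (by rw [div_le_iff₀ hn0]; linarith)
      have h4 := hganti s ((m + 1) / n) hs (by rw [le_div_iff₀ hn0]; linarith)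
      have h5 := mul_le_mul_of_nonneg_left h3 hm0.le
      have h6 := mul_le_mul_of_nonneg_left h4 (show (0 : ℝ) ≤ m + 1 by positivity)
      have h7 := mul_le_mul_of_nonneg_right hfl hgsp.le
      have h8 := mul_le_mul_of_nonneg_right hfu.le hgsp.le
      have hab : |g 1 - s * g s| * n = |(g 1 - s * g s) * n| := by rw [abs_mul, abs_of_pos hn0]
      rw [hab, abs_le]
      constructor <;> nlinarith
    by_contra hne
    have habs : 0 < |g 1 - s * g s| := abs_pos.2 fun h => hne (by linarith)
    have hT : Tendsto (fun n : ℕ => |g 1 - s * g s| * (n : ℝ)) atTop atTop :=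
      tendsto_natCast_atTop_atTop.const_mul_atTop habs
    have hT2 : Tendsto (fun n : ℕ => (n : ℝ) * s) atTop atTop :=
      tendsto_natCast_atTop_atTop.atTop_mul_const hs
    obtain ⟨n, h1, h2⟩ := ((hT.eventually_gt_atTop (g s)).and (hT2.eventually_ge_atTop 1)).exists
    exact absurd (key n h2) (not_le.2 h1)
  refine ⟨g 1 ^ (1 / α), Real.rpow_pos_of_pos (hgpos 1 one_pos) _, fun x => ?_⟩
  split_ifs with hx
  · have hxα : 0 < x ^ α := Real.rpow_pos_of_pos hx _
    have hHx : H (x ^ α) = F x := by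
      simp only [hH]
      rw [← Real.rpow_mul hx.le, mul_one_div_cancel hα.ne', Real.rpow_one]
    rw [← Real.rpow_mul (hgpos 1 one_pos).le, one_div_mul_cancel hα.ne', Real.rpow_one,
      ← hgone _ hxα, Real.rpow_neg hx.le, mul_comm (x ^ α), mul_assoc,
      mul_inv_cancel₀ hxα.ne', mul_one]
    simp only [hg, neg_neg]
    rw [Real.exp_log (hHpos _ hxα), hHx]
  · rcases (not_lt.1 hx).lt_or_eq with h | h
    · exact hneg x h
    · rw [h, hzero]

/-! ### Max-stable vectors -/

/-- The difference of two unions is covered by the differences of the sets; with all `A i` empty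
this is the union bound. -/
theorem measureReal_iUnion_sub_le {Ω ι : Type*} [MeasurableSpace Ω] [Fintype ι] {Q : Measure Ω}
    [IsFiniteMeasure Q] {A B : ι → Set Ω} (hA : ∀ i, MeasurableSet (A i))
    (hAB : ∀ i, A i ⊆ B i) :
    Q.real (⋃ i, B i) - Q.real (⋃ i, A i) ≤ ∑ i, (Q.real (B i) - Q.real (A i)) := by
  have h1 : Q.real (⋃ i, B i) ≤ Q.real (⋃ i, A i) + Q.real (⋃ i, B i \ A i) := by
    refine (measureReal_mono ?_).trans (measureReal_union_le _ _)
    intro ω hω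
    obtain ⟨i, hi⟩ := Set.mem_iUnion.1 hω
    by_cases h : ω ∈ A i
    · exact Or.inl (Set.mem_iUnion.2 ⟨i, h⟩)
    · exact Or.inr (Set.mem_iUnion.2 ⟨i, hi, h⟩)
  have h2 : Q.real (⋃ i, B i \ A i) ≤ ∑ i, (Q.real (B i) - Q.real (A i)) := by
    refine (measureReal_iUnion_fintype_le _).trans (le_of_eq ?_)
    exact Finset.sum_congr rfl fun i _ => measureReal_sdiff (hAB i) (hA i)
  linarith

/-- The norming constants serve the joint law (`J = Set.univ`) and the marginals (`J = {i}`)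
simultaneously. -/
theorem IsMaxStableLaw.exists_norming {Ω ι : Type*} [MeasurableSpace Ω] [Fintype ι] {Q : Measure Ω}
    [IsProbabilityMeasure Q] {Y : ι → Ω → ℝ} (hY : ∀ i, Measurable (Y i))
    (h : IsMaxStableLaw (Q.map (fun ω i => Y i ω))) {n : ℕ} (hn : 1 ≤ n) :
    ∃ a b : ι → ℝ, (∀ i, 0 < a i) ∧ ∀ (J : Set ι) (z : ι → ℝ),
      Q.real {ω | ∀ i ∈ J, Y i ω ≤ a i * z i + b i} ^ n = Q.real {ω | ∀ i ∈ J, Y i ω ≤ z i} := by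
  obtain ⟨a, b, ha, hab⟩ := h n hn
  have hYm : Measurable (fun ω i => Y i ω) := measurable_pi_lambda _ hY
  have : IsProbabilityMeasure (Q.map (fun ω i => Y i ω)) :=
    Measure.isProbabilityMeasure_map hYm.aemeasurable
  refine ⟨a, b, ha, fun J z => ?_⟩
  set w : ι → ℝ := fun i => a i * z i + b i with hw
  have hmeas : ∀ v : ι → ℝ, MeasurableSet {y : ι → ℝ | ∀ i ∈ J, y i ≤ v i} := fun v => by
    have : {y : ι → ℝ | ∀ i ∈ J, y i ≤ v i} = ⋂ i, ⋂ (_ : i ∈ J), {y | y i ≤ v i} := by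
      ext; simp
    rw [this]
    exact MeasurableSet.iInter fun i => MeasurableSet.iInter fun _ =>
      measurableSet_le (measurable_pi_apply i) measurable_const
  have key := congrArg (fun ν : Measure (ι → ℝ) => ν {y | ∀ i ∈ J, y i ≤ w i}) hab
  have hsup : Measurable (fun (y : Fin n → ι → ℝ) i => ⨆ j : Fin n, y j i) :=
    measurable_pi_lambda _ fun i => Measurable.iSup fun j =>
      (measurable_pi_apply i).comp (measurable_pi_apply j)
  have haff : Measurable (fun (y : ι → ℝ) i => a i * y i + b i) :=
    measurable_pi_lambda _ fun i => ((measurable_pi_apply i).const_mul _).add_const _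
  rw [Measure.map_apply hsup (hmeas w), Measure.map_apply haff (hmeas w),
    Measure.map_apply hYm (haff (hmeas w))] at key
  have hne : Nonempty (Fin n) := ⟨⟨0, by omega⟩⟩
  have e1 : (fun (y : Fin n → ι → ℝ) i => ⨆ j : Fin n, y j i) ⁻¹' {y | ∀ i ∈ J, y i ≤ w i}
      = Set.pi Set.univ (fun _ : Fin n => {y : ι → ℝ | ∀ i ∈ J, y i ≤ w i}) := by
    ext y
    simp only [Set.mem_preimage, Set.mem_ofPred_eq, Set.mem_pi, Set.mem_univ, true_imp_iff]
    constructor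
    · intro hy j i hi
      exact (le_ciSup (Set.finite_range _).bddAbove j).trans (hy i hi)
    · intro hy i hi
      exact ciSup_le fun j => hy j i hi
  have e2 : (fun ω i => Y i ω) ⁻¹' ((fun (y : ι → ℝ) i => a i * y i + b i) ⁻¹'
      {y | ∀ i ∈ J, y i ≤ w i}) = {ω | ∀ i ∈ J, Y i ω ≤ z i} := by
    ext ω
    simp only [Set.mem_preimage, Set.mem_ofPred_eq, hw, add_le_add_iff_right]
    exact forall₂_congr fun i _ => mul_le_mul_iff_right₀ (ha i)
  rw [e1, Measure.pi_pi, Measure.map_apply hYm (hmeas w), e2, Finset.prod_const, Finset.card_univ,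
    Fintype.card_fin] at key
  have := congrArg ENNReal.toReal key
  rw [ENNReal.toReal_pow] at this
  exact this

theorem tendsto_natCast_mul_rpow_inv_sub_one {x : ℝ} (hx : 0 < x) :
    Tendsto (fun n : ℕ => (n : ℝ) * (x ^ ((n : ℝ)⁻¹) - 1)) atTop (𝓝 (Real.log x)) := by
  have h1 : Tendsto (fun n : ℕ => ((n : ℝ)⁻¹)) atTop (𝓝[>] 0) :=
    tendsto_inv_atTop_nhdsGT_zero.comp tendsto_natCast_atTop_atTop
  simpa [Function.comp_def] using (tendsto_rpow_sub_one_log hx).comp h1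

/-- An inequality between `n`-th roots, for all `n`, passes to logarithms through
`n * (x ^ (1 / n) - 1) → log x`. -/
theorem mul_prod_le_of_rpow_inv {ι : Type*} [Fintype ι] {g g' : ℝ} {p q : ι → ℝ} (hg : 0 ≤ g)
    (hg' : 0 < g') (hp : ∀ i, 0 < p i) (hq : ∀ i, 0 < q i)
    (h : ∀ n : ℕ, 1 ≤ n → g' ^ ((n : ℝ)⁻¹) - g ^ ((n : ℝ)⁻¹)
      ≤ ∑ i, (q i ^ ((n : ℝ)⁻¹) - p i ^ ((n : ℝ)⁻¹))) :
    g' * ∏ i, p i ≤ g * ∏ i, q i := by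
  have hone : ∀ x : ℝ, 0 < x → Tendsto (fun n : ℕ => x ^ ((n : ℝ)⁻¹)) atTop (𝓝 1) := by
    intro x hx
    have := (Real.continuousAt_const_rpow hx.ne' (b := 0)).tendsto.comp
      tendsto_inv_atTop_nhds_zero_nat
    simpa [Function.comp_def] using this
  -- for `g = 0` all roots `g ^ (1 / n)` vanish, while the roots of positive numbers tend to `1`
  have hgpos : 0 < g := by
    refine lt_of_le_of_ne hg fun h0 => ?_
    have hR : Tendsto (fun n : ℕ => ∑ i, (q i ^ ((n : ℝ)⁻¹) - p i ^ ((n : ℝ)⁻¹))) atTop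
        (𝓝 (∑ _i : ι, ((1 : ℝ) - 1))) :=
      tendsto_finsetSum _ fun i _ => (hone _ (hq i)).sub (hone _ (hp i))
    have := le_of_tendsto_of_tendsto (hone g' hg') hR (by
      filter_upwards [eventually_ge_atTop 1] with n hn
      have h1 := h n hn
      rwa [← h0, Real.zero_rpow (by positivity), sub_zero] at h1)
    norm_num at this
  have hlog : Real.log g' - Real.log g ≤ ∑ i, (Real.log (q i) - Real.log (p i)) := by
    refine le_of_tendsto_of_tendsto ((tendsto_natCast_mul_rpow_inv_sub_one hg').sub
      (tendsto_natCast_mul_rpow_inv_sub_one hgpos)) (tendsto_finsetSum _ fun i _ =>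
      (tendsto_natCast_mul_rpow_inv_sub_one (hq i)).sub
        (tendsto_natCast_mul_rpow_inv_sub_one (hp i))) ?_
    filter_upwards [eventually_ge_atTop 1] with n hn
    have h1 := mul_le_mul_of_nonneg_left (h n hn) (Nat.cast_nonneg (α := ℝ) n)
    rw [Finset.mul_sum] at h1
    calc _ = (n : ℝ) * (g' ^ ((n : ℝ)⁻¹) - g ^ ((n : ℝ)⁻¹)) := by ring
      _ ≤ _ := h1
      _ = _ := Finset.sum_congr rfl fun i _ => by ring
  have hP : 0 < ∏ i, p i := Finset.prod_pos fun i _ => hp i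
  have hR : 0 < ∏ i, q i := Finset.prod_pos fun i _ => hq i
  rw [← Real.log_le_log_iff (by positivity) (by positivity), Real.log_mul hg'.ne' hP.ne',
    Real.log_mul hgpos.ne' hR.ne', Real.log_prod fun i _ => (hp i).ne',
    Real.log_prod fun i _ => (hq i).ne']
  rw [Finset.sum_sub_distrib] at hlog
  linarith

section
variable {Ω ι : Type*} [MeasurableSpace Ω] [Fintype ι] {Q : Measure Ω}
    [IsProbabilityMeasure Q] {Y : ι → Ω → ℝ}

theorem measureReal_forall_le {z : ι → ℝ} (hY : ∀ i, Measurable (Y i)) :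
    Q.real {ω | ∀ i, Y i ω ≤ z i} = 1 - Q.real (⋃ i, {ω | Y i ω ≤ z i}ᶜ) := by
  have hm : ∀ i, MeasurableSet {ω | Y i ω ≤ z i} := fun i =>
    measurableSet_le (hY i) measurable_const
  have : {ω | ∀ i, Y i ω ≤ z i} = (⋃ i, {ω | Y i ω ≤ z i}ᶜ)ᶜ := by
    ext; simp
  rw [this, probReal_compl_eq_one_sub (MeasurableSet.iUnion fun i => (hm i).compl)]

/-- Max-stable vectors are positively lower orthant dependent. -/
theorem IsMaxStableLaw.prod_le (hY : ∀ i, Measurable (Y i))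
    (h : IsMaxStableLaw (Q.map (fun ω i => Y i ω))) {x : ι → ℝ} :
    ∏ i, Q.real {ω | Y i ω ≤ x i} ≤ Q.real {ω | ∀ i, Y i ω ≤ x i} := by
  by_cases hx : ∀ i, 0 < Q.real {ω | Y i ω ≤ x i}
  swap
  · push Not at hx
    obtain ⟨i, hi⟩ := hx
    rw [Finset.prod_eq_zero (Finset.mem_univ i) (le_antisymm hi measureReal_nonneg)]
    exact measureReal_nonneg
  have := mul_prod_le_of_rpow_inv (g := Q.real {ω | ∀ i, Y i ω ≤ x i}) (g' := 1)
    (p := fun i => Q.real {ω | Y i ω ≤ x i}) (q := fun _ => 1) measureReal_nonneg one_pos hx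
    (fun _ => one_pos) ?_
  · simpa using this
  intro n hn
  have hn0 : n ≠ 0 := by omega
  obtain ⟨a, b, -, hab⟩ := h.exists_norming hY hn
  have h1 := hab Set.univ x
  have h2 := fun i => hab {i} x
  simp only [Set.mem_univ, true_imp_iff, Set.mem_singleton_iff, forall_eq] at h1 h2
  simp only [← h1, ← h2, Real.one_rpow]
  rw [Real.pow_rpow_inv_natCast measureReal_nonneg hn0, measureReal_forall_le hY, sub_sub_cancel]
  refine (measureReal_iUnion_fintype_le _).trans (le_of_eq (Finset.sum_congr rfl fun i _ => ?_))
  rw [Real.pow_rpow_inv_natCast measureReal_nonneg hn0,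
    probReal_compl_eq_one_sub (measurableSet_le (hY i) measurable_const)]

/-- The ratio of the joint distribution function to the product of its marginals is antitone. -/
theorem IsMaxStableLaw.mul_prod_le_mul_prod (hY : ∀ i, Measurable (Y i))
    (h : IsMaxStableLaw (Q.map (fun ω i => Y i ω))) {x y : ι → ℝ} (hxy : ∀ i, x i ≤ y i)
    (hx : ∀ i, 0 < Q.real {ω | Y i ω ≤ x i}) :
    Q.real {ω | ∀ i, Y i ω ≤ y i} * ∏ i, Q.real {ω | Y i ω ≤ x i}
      ≤ Q.real {ω | ∀ i, Y i ω ≤ x i} * ∏ i, Q.real {ω | Y i ω ≤ y i} := by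
  have hy : ∀ i, 0 < Q.real {ω | Y i ω ≤ y i} := fun i =>
    (hx i).trans_le (measureReal_mono fun ω hω => le_trans hω (hxy i))
  refine mul_prod_le_of_rpow_inv measureReal_nonneg
    ((Finset.prod_pos fun i _ => hy i).trans_le (h.prod_le hY)) hx hy fun n hn => ?_
  have hn0 : n ≠ 0 := by omega
  obtain ⟨a, b, ha, hab⟩ := h.exists_norming hY hn
  have h1 := hab Set.univ
  have h2 := fun i => hab {i}
  simp only [Set.mem_univ, true_imp_iff, Set.mem_singleton_iff, forall_eq] at h1 h2
  have hm : ∀ (i : ι) (c : ℝ), MeasurableSet {ω | Y i ω ≤ c} := fun i c =>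
    measurableSet_le (hY i) measurable_const
  have key := measureReal_iUnion_sub_le (Q := Q)
    (A := fun i => {ω | Y i ω ≤ a i * y i + b i}ᶜ) (B := fun i => {ω | Y i ω ≤ a i * x i + b i}ᶜ)
    (fun i => (hm _ _).compl) (fun i => Set.compl_subset_compl.2 fun ω hω => le_trans
      (show Y i ω ≤ a i * x i + b i from hω)
      (add_le_add_left (mul_le_mul_of_nonneg_left (hxy i) (ha i).le) _))
  simp only [probReal_compl_eq_one_sub (hm _ _), sub_sub_sub_cancel_left] at key
  have e := fun z => measureReal_forall_le (Q := Q) (z := z) hY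
  rw [← h1 x, ← h1 y]
  simp only [← h2 _ x, ← h2 _ y, Real.pow_rpow_inv_natCast measureReal_nonneg hn0]
  rw [e, e]
  linarith

/-- The ratio of the joint distribution function to the product of the marginals is antitone and at
least `1`; if it equals `1` at the point with all coordinates `min x`, then it equals `1` at `x`. -/
theorem IsMaxStableLaw.eq_prod_of_diagonal (hY : ∀ i, Measurable (Y i))
    (h : IsMaxStableLaw (Q.map (fun ω i => Y i ω)))
    (hd : ∀ t : ℝ, Q.real {ω | ∀ i, Y i ω ≤ t} = ∏ i, Q.real {ω | Y i ω ≤ t})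
    (hs : ∀ i j t, Q.real {ω | Y i ω ≤ t} = Q.real {ω | Y j ω ≤ t}) (x : ι → ℝ) :
    Q.real {ω | ∀ i, Y i ω ≤ x i} = ∏ i, Q.real {ω | Y i ω ≤ x i} := by
  refine le_antisymm ?_ (h.prod_le hY)
  by_cases hx : ∀ i, 0 < Q.real {ω | Y i ω ≤ x i}
  swap
  · push Not at hx
    obtain ⟨i, hi⟩ := hx
    exact (measureReal_mono fun ω (hω : ∀ i, Y i ω ≤ x i) => hω i).trans (hi.trans
      (Finset.prod_nonneg fun i _ => measureReal_nonneg))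
  rcases isEmpty_or_nonempty ι with hι | hι
  · simp
  obtain ⟨j, hj⟩ := Finite.exists_min x
  have hpos : ∀ i, 0 < Q.real {ω | Y i ω ≤ x j} := fun i => by rw [hs i j]; exact hx j
  have key := h.mul_prod_le_mul_prod hY hj hpos
  rw [hd, mul_comm] at key
  exact le_of_mul_le_mul_left key (Finset.prod_pos fun i _ => hpos i)

end

theorem iIndepFun_of_forall_le {Ω κ : Type*} [MeasurableSpace Ω] {Q : Measure Ω}
    [IsProbabilityMeasure Q] {Z : κ → Ω → ℝ} (hZ : ∀ k, Measurable (Z k))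
    (h : ∀ (I : Finset κ) (x : κ → ℝ),
      Q.real {ω | ∀ i ∈ I, Z i ω ≤ x i} = ∏ i ∈ I, Q.real {ω | Z i ω ≤ x i}) :
    iIndepFun Z Q := by
  rw [iIndepFun_iff_iIndep]
  refine iIndepSets.iIndep (fun i => (hZ i).comap_le)
    (fun i => Set.preimage (Z i) '' (Set.range Set.Iic))
    (fun i => ?_) (fun i => ?_) ?_
  · rintro _ ⟨_, ⟨s, rfl⟩, rfl⟩ _ ⟨_, ⟨t, rfl⟩, rfl⟩ -
    exact ⟨Set.Iic (s ⊓ t), ⟨_, rfl⟩, by rw [← Set.preimage_inter, Set.Iic_inter_Iic]⟩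
  · rw [show Real.measurableSpace = MeasurableSpace.generateFrom (Set.range Set.Iic)
      from BorelSpace.measurable_eq.trans (borel_eq_generateFrom_Iic ℝ),
      MeasurableSpace.comap_generateFrom]
  · rw [iIndepSets_iff]
    intro I f hf
    choose! s hs hsf using hf
    choose! t ht using hs
    have e : ⋂ i ∈ I, f i = {ω | ∀ i ∈ I, Z i ω ≤ t i} := by
      ext ω
      simp only [Set.mem_iInter, Set.mem_ofPred_eq]
      refine forall₂_congr fun i hi => ?_
      rw [← hsf i hi, ← ht i hi]; rfl
    rw [e, ← ENNReal.toReal_eq_toReal_iff' (measure_ne_top _ _)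
      (ENNReal.prod_ne_top fun _ _ => measure_ne_top _ _), ENNReal.toReal_prod]
    refine (h I t).trans (Finset.prod_congr rfl fun i hi => ?_)
    rw [← hsf i hi, ← ht i hi]; rfl

/-! ### Block maxima and their scaling limits -/

theorem blockMax_le_iff {Ω : Type*} {X : ℤ → Ω → ℝ} {m : ℕ} (hm : 1 ≤ m) (k : ℕ) (ω : Ω) (c : ℝ) :
    blockMax X m k ω ≤ c ↔ ∀ i < m, X ((m : ℤ) * k + i + 1) ω ≤ c := by
  have hne : Nonempty (Fin m) := ⟨⟨0, by omega⟩⟩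
  unfold blockMax
  rw [ciSup_le_iff (Set.finite_range _).bddAbove]
  exact ⟨fun h i hi => h ⟨i, hi⟩, fun h i => h i i.2⟩

theorem blockMax_mul_le_iff {Ω : Type*} {X : ℤ → Ω → ℝ} {m n : ℕ} (hm : 1 ≤ m) (hn : 1 ≤ n)
    (ω : Ω) (c : ℝ) :
    blockMax X (n * m) 0 ω ≤ c ↔ ∀ k < n, blockMax X m k ω ≤ c := by
  rw [blockMax_le_iff (Nat.mul_pos hn hm)]
  simp only [blockMax_le_iff hm]
  constructor
  · intro h k hk i hi
    have := h (m * k + i) (by nlinarith)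
    simpa using this
  · intro h i hi
    have := h (i / m) (Nat.div_lt_of_lt_mul (by rwa [mul_comm])) (i % m) (Nat.mod_lt _ hm)
    have e : (m : ℤ) * ((i / m : ℕ) : ℤ) + ((i % m : ℕ) : ℤ) = i := by
      exact_mod_cast Nat.div_add_mod i m
    rw [e] at this
    simpa using this

section
variable {Ω : Type*} [MeasurableSpace Ω] {P : Measure Ω} {X : ℤ → Ω → ℝ}

theorem IsStrictlyStationary.identDistrib_apply (h : IsStrictlyStationary X P) (k l : ℤ) :
    IdentDistrib (X k) (X l) P P := by
  have := (h {l} (k - l)).comp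
    (measurable_pi_apply (⟨l, Finset.mem_singleton_self l⟩ : ({l} : Finset ℤ)))
  simpa [Function.comp_def] using this

theorem IsStrictlyStationary.identDistrib_blockMax (h : IsStrictlyStationary X P) (m k : ℕ) :
    IdentDistrib (blockMax X m k) (blockMax X m 0) P P := by
  have hmem : ∀ i : Fin m, (((i : ℕ) : ℤ) + 1) ∈ Finset.Icc (1 : ℤ) m := fun i => by
    have := i.2
    rw [Finset.mem_Icc]; omega
  have hφ : Measurable (fun y : Finset.Icc (1 : ℤ) m → ℝ => ⨆ i : Fin m, y ⟨_, hmem i⟩) :=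
    Measurable.iSup fun i => measurable_pi_apply _
  have := (h (Finset.Icc (1 : ℤ) m) ((m : ℤ) * k)).comp hφ
  convert this using 1
  · ext ω
    refine iSup_congr fun i => ?_
    rw [show (m : ℤ) * k + ((i : ℕ) : ℤ) + 1 = ((i : ℕ) : ℤ) + 1 + m * k by ring]
  · ext ω
    simp [blockMax]

end

theorem MeasureTheory.TendstoInDistribution.le_liminf_measure_open {Ω Ω' E : Type*}
    [MeasurableSpace Ω] [MeasurableSpace Ω'] [TopologicalSpace E] [MeasurableSpace E]
    [OpensMeasurableSpace E] [HasOuterApproxClosed E] {P : Measure Ω} [IsProbabilityMeasure P]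
    {Q : Measure Ω'} [IsProbabilityMeasure Q] {Y : ℕ → Ω → E} {Z : Ω' → E}
    (h : TendstoInDistribution Y atTop Z (fun _ => P) Q) {U : Set E} (hU : IsOpen U) :
    Q (Z ⁻¹' U) ≤ atTop.liminf fun m => P (Y m ⁻¹' U) := by
  have := ProbabilityMeasure.le_liminf_measure_open_of_tendsto h.tendsto hU
  simp only [ProbabilityMeasure.coe_mk] at this
  rw [Measure.map_apply_of_aemeasurable h.aemeasurable_limit hU.measurableSet] at this
  refine this.trans (le_of_eq ?_)
  congr 1; ext m
  rw [Measure.map_apply_of_aemeasurable (h.forall_aemeasurable m) hU.measurableSet]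

/-- The portmanteau inequality for an open set, for real-valued bounds with a limit. -/
theorem MeasureTheory.TendstoInDistribution.measureReal_open_le {Ω Ω' E : Type*}
    [MeasurableSpace Ω] [MeasurableSpace Ω'] [TopologicalSpace E] [MeasurableSpace E]
    [OpensMeasurableSpace E] [HasOuterApproxClosed E] {P : Measure Ω} [IsProbabilityMeasure P]
    {Q : Measure Ω'} [IsProbabilityMeasure Q] {Y : ℕ → Ω → E} {Z : Ω' → E}
    (h : TendstoInDistribution Y atTop Z (fun _ => P) Q) {U : Set E} (hU : IsOpen U)
    {r : ℕ → ℝ} {c : ℝ} (hr : Tendsto r atTop (𝓝 c))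
    (hle : ∀ᶠ m in atTop, P.real (Y m ⁻¹' U) ≤ r m) : Q.real (Z ⁻¹' U) ≤ c := by
  have hc : 0 ≤ c := ge_of_tendsto hr (hle.mono fun m hm => measureReal_nonneg.trans hm)
  refine ENNReal.toReal_le_of_le_ofReal hc ((h.le_liminf_measure_open hU).trans ?_)
  have hT : Tendsto (fun m => ENNReal.ofReal (r m)) atTop (𝓝 (ENNReal.ofReal c)) :=
    (ENNReal.continuous_ofReal.tendsto c).comp hr
  rw [← hT.liminf_eq]
  refine liminf_le_liminf (hle.mono fun m hm => ?_)
  rw [← ENNReal.ofReal_toReal (measure_ne_top P (Y m ⁻¹' U))]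
  exact ENNReal.ofReal_le_ofReal hm

theorem TendstoFDD.tendsto_apply {Ω Ω' : Type*} [MeasurableSpace Ω] [MeasurableSpace Ω']
    {Y : ℕ → ℕ → Ω → ℝ} {Z : ℕ → Ω' → ℝ} {P : Measure Ω} [IsProbabilityMeasure P]
    {Q : Measure Ω'} [IsProbabilityMeasure Q] (h : TendstoFDD Y Z P Q) (k : ℕ) :
    TendstoInDistribution (fun m ω => Y m k ω) atTop (Z k) (fun _ => P) Q :=
  (h {k}).continuous_comp
    (continuous_apply (⟨k, Finset.mem_singleton_self k⟩ : ({k} : Finset ℕ)))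

section
variable {Ω Ω' : Type*} [MeasurableSpace Ω] [MeasurableSpace Ω'] {P : Measure Ω}
  [IsProbabilityMeasure P] {Q : Measure Ω'} [IsProbabilityMeasure Q] {X : ℤ → Ω → ℝ}
  {Z : ℕ → Ω' → ℝ} {α σ₀ : ℝ}

theorem identDistrib_of_tendstoFDD_blockMax (hZ : ∀ k, Measurable (Z k))
    (hstat : IsStrictlyStationary X P)
    (hconv : TendstoFDD (fun m k ω => blockMax X m k ω / (m : ℝ) ^ (1 / α)) Z P Q) (k : ℕ) :
    IdentDistrib (Z k) (Z 0) Q Q := by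
  refine ⟨(hZ k).aemeasurable, (hZ 0).aemeasurable, ?_⟩
  have hk := hconv.tendsto_apply k
  have h0 := hconv.tendsto_apply 0
  refine tendstoInDistribution_unique _ hk ⟨hk.forall_aemeasurable, h0.aemeasurable_limit, ?_⟩
  refine Tendsto.congr (fun m => Subtype.ext ?_) h0.tendsto
  exact ((hstat.identDistrib_blockMax m k).comp
    (measurable_id.div_const ((m : ℝ) ^ (1 / α)))).map_eq.symm

/-- Max-self-similarity of the limit: joining `n` consecutive blocks into one changes the
normalisation by the factor `n ^ (1 / α)`. -/
theorem measureReal_forall_le_of_tendstoFDD_blockMax (hZ : ∀ k, Measurable (Z k))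
    (hconv : TendstoFDD (fun m k ω => blockMax X m k ω / (m : ℝ) ^ (1 / α)) Z P Q)
    {n : ℕ} (hn : 1 ≤ n) (x : ℝ) :
    Q.real {ω | ∀ i ∈ Finset.range n, Z i ω ≤ (n : ℝ) ^ (1 / α) * x} = Q.real {ω | Z 0 ω ≤ x} := by
  have hne : (Finset.univ : Finset (Finset.range n)).Nonempty :=
    ⟨⟨0, Finset.mem_range.2 (by omega)⟩, Finset.mem_univ _⟩
  set φ : (Finset.range n → ℝ) → ℝ := fun y => Finset.univ.sup' hne y with hφ
  have hφc : Continuous φ := by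
    have := Continuous.finset_sup'_apply (s := (Finset.univ : Finset (Finset.range n)))
      (f := fun i (y : Finset.range n → ℝ) => y i) hne fun i _ => continuous_apply i
    exact this
  have hφle : ∀ y c, φ y ≤ c ↔ ∀ i, y i ≤ c := fun y c => by simp [hφ]
  have hnp : 0 < (n : ℝ) ^ (1 / α) := Real.rpow_pos_of_pos (by exact_mod_cast hn) _
  have h1 := (hconv (Finset.range n)).continuous_comp hφc
  have h2 := (hconv.tendsto_apply 0).continuous_comp (continuous_const_mul ((n : ℝ) ^ (1 / α)))
  -- block lengths `m + 1`, because the block maximum of length `0` is the junk value `0`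
  have hsub1 : Tendsto (fun m : ℕ => m + 1) atTop atTop := tendsto_add_atTop_nat 1
  have hsub2 : Tendsto (fun m : ℕ => n * (m + 1)) atTop atTop :=
    tendsto_atTop_mono (fun m => Nat.le_mul_of_pos_left _ hn) hsub1
  have heq : ∀ m : ℕ, (φ ∘ fun ω (k : Finset.range n) =>
        blockMax X (m + 1) k ω / ((m + 1 : ℕ) : ℝ) ^ (1 / α))
      = ((fun t => (n : ℝ) ^ (1 / α) * t) ∘ fun ω =>
        blockMax X (n * (m + 1)) 0 ω / ((n * (m + 1) : ℕ) : ℝ) ^ (1 / α)) := by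
    intro m
    ext ω
    have hmp : 0 < ((m + 1 : ℕ) : ℝ) ^ (1 / α) := Real.rpow_pos_of_pos (by positivity) _
    refine eq_of_forall_ge_iff fun c => ?_
    have e : (n : ℝ) ^ (1 / α) * (blockMax X (n * (m + 1)) 0 ω /
        ((n * (m + 1) : ℕ) : ℝ) ^ (1 / α))
        = blockMax X (n * (m + 1)) 0 ω / ((m + 1 : ℕ) : ℝ) ^ (1 / α) := by
      rw [Nat.cast_mul, Real.mul_rpow (by positivity) (by positivity)]
      field_simp
    simp only [Function.comp_apply]
    rw [e, div_le_iff₀ hmp, blockMax_mul_le_iff (by omega) hn, hφle]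
    simp only [div_le_iff₀ hmp, Subtype.forall, Finset.mem_range]
  have hlim := tendstoInDistribution_unique
    (fun m => φ ∘ fun ω (k : Finset.range n) =>
        blockMax X (m + 1) k ω / ((m + 1 : ℕ) : ℝ) ^ (1 / α))
    (h1 := ⟨fun m => h1.forall_aemeasurable (m + 1), h1.aemeasurable_limit, h1.tendsto.comp hsub1⟩)
    (h2 := ⟨fun m => h1.forall_aemeasurable (m + 1), h2.aemeasurable_limit, by
      refine Tendsto.congr (fun m => Subtype.ext ?_) (h2.tendsto.comp hsub2)
      exact (congrArg (fun f => P.map f) (heq m)).symm⟩)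
  have key := congrArg (fun ν : Measure ℝ => ν.real (Set.Iic ((n : ℝ) ^ (1 / α) * x))) hlim
  have hZm : Measurable (φ ∘ fun ω (k : Finset.range n) => Z k ω) :=
    hφc.measurable.comp (measurable_pi_lambda _ fun k => hZ k)
  rw [map_measureReal_apply hZm measurableSet_Iic,
    map_measureReal_apply ((measurable_const_mul _).comp (hZ 0)) measurableSet_Iic] at key
  convert key using 2
  · ext ω
    simp [hφle]
  · ext ω
    exact (mul_le_mul_iff_right₀ hnp).symm

/-- The union bound for the block maximum, in the limit. -/
theorem measureReal_lt_of_tendstoFDD_blockMax (hα : 0 < α)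
    (hstat : IsStrictlyStationary X P) (htail : ∀ k, IsHeavyTailed α σ₀ (X k) P)
    (hσ₀ : 0 < σ₀)
    (hconv : TendstoFDD (fun m k ω => blockMax X m k ω / (m : ℝ) ^ (1 / α)) Z P Q)
    {x : ℝ} (hx : 0 < x) : Q.real {ω | x < Z 0 ω} ≤ σ₀ ^ α * x ^ (-α) := by
  set f : ℝ → ℝ := fun t => P.real {ω | t < X 1 ω}
  have hev : ∀ᶠ t in atTop, σ₀ ^ α * t ^ (-α) ≠ 0 := by
    filter_upwards [eventually_gt_atTop 0] with t ht
    positivity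
  have hlim : Tendsto (fun t => f t / (σ₀ ^ α * t ^ (-α))) atTop (𝓝 1) :=
    (isEquivalent_iff_tendsto_one hev).1 (htail 1)
  have hT : Tendsto (fun m : ℕ => x * (m : ℝ) ^ (1 / α)) atTop atTop :=
    ((tendsto_rpow_atTop (by positivity)).comp tendsto_natCast_atTop_atTop).const_mul_atTop hx
  have hr : Tendsto (fun m : ℕ => (m : ℝ) * f (x * (m : ℝ) ^ (1 / α))) atTop
      (𝓝 (σ₀ ^ α * x ^ (-α))) := by
    have := (hlim.comp hT).mul_const (σ₀ ^ α * x ^ (-α))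
    rw [one_mul] at this
    refine this.congr' ?_
    filter_upwards [eventually_ge_atTop 1] with m hm
    have hm0 : (0 : ℝ) < m := by exact_mod_cast hm
    have e : (x * (m : ℝ) ^ (1 / α)) ^ (-α) = x ^ (-α) * (m : ℝ)⁻¹ := by
      rw [Real.mul_rpow hx.le (by positivity), ← Real.rpow_mul hm0.le]
      congr 1
      rw [show 1 / α * -α = -1 by field_simp, Real.rpow_neg_one]
    simp only [Function.comp_apply, e]
    have : 0 < σ₀ ^ α := by positivity
    have : 0 < x ^ (-α) := by positivity
    field_simp
  refine (hconv.tendsto_apply 0).measureReal_open_le (isOpen_Ioi (a := x)) hr ?_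
  filter_upwards [eventually_ge_atTop 1] with m hm
  have hmp : 0 < (m : ℝ) ^ (1 / α) := Real.rpow_pos_of_pos (by exact_mod_cast hm) _
  have hsub : (fun ω => blockMax X m 0 ω / (m : ℝ) ^ (1 / α)) ⁻¹' Set.Ioi x
      ⊆ ⋃ i : Fin m, {ω | x * (m : ℝ) ^ (1 / α) < X (((i : ℕ) : ℤ) + 1) ω} := by
    intro ω hω
    rw [Set.mem_preimage, Set.mem_Ioi, lt_div_iff₀ hmp] at hω
    have := (blockMax_le_iff hm 0 ω (x * (m : ℝ) ^ (1 / α))).not.1 (not_le.2 hω)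
    push Not at this
    obtain ⟨i, hi, h⟩ := this
    refine Set.mem_iUnion.2 ⟨⟨i, hi⟩, ?_⟩
    simpa using h
  refine (measureReal_mono hsub).trans ((measureReal_iUnion_fintype_le _).trans (le_of_eq ?_))
  have : ∀ i : Fin m, P.real {ω | x * (m : ℝ) ^ (1 / α) < X (((i : ℕ) : ℤ) + 1) ω}
      = f (x * (m : ℝ) ^ (1 / α)) := fun i =>
    congrArg ENNReal.toReal ((hstat.identDistrib_apply _ 1).measure_mem_eq measurableSet_Ioi)
  rw [Finset.sum_congr rfl fun i _ => this i, Finset.sum_const, Finset.card_univ, Fintype.card_fin,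
    nsmul_eq_mul]

/-- The block maximum is at least the first variable of the block, which is negligible after
normalisation; so the limit is nonnegative although the lower tail of `X` is arbitrary. -/
theorem measureReal_neg_of_tendstoFDD_blockMax (hX : ∀ k, Measurable (X k)) (hα : 0 < α)
    (hconv : TendstoFDD (fun m k ω => blockMax X m k ω / (m : ℝ) ^ (1 / α)) Z P Q)
    {x : ℝ} (hx : x < 0) : Q.real {ω | Z 0 ω < x} = 0 := by
  refine le_antisymm ?_ measureReal_nonneg
  have hT : Tendsto (fun m : ℕ => x * (m : ℝ) ^ (1 / α)) atTop atBot :=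
    ((tendsto_rpow_atTop (by positivity)).comp
      tendsto_natCast_atTop_atTop).const_mul_atTop_of_neg hx
  have hP : IsProbabilityMeasure (P.map (X 1)) :=
    Measure.isProbabilityMeasure_map (hX 1).aemeasurable
  have hr := (tendsto_cdf_atBot (P.map (X 1))).comp hT
  refine (hconv.tendsto_apply 0).measureReal_open_le (isOpen_Iio (a := x)) hr ?_
  filter_upwards [eventually_ge_atTop 1] with m hm
  have hmp : 0 < (m : ℝ) ^ (1 / α) := Real.rpow_pos_of_pos (by exact_mod_cast hm) _
  rw [Function.comp_apply, cdf_eq_real, map_measureReal_apply (hX 1) measurableSet_Iic]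
  refine measureReal_mono fun ω hω => ?_
  rw [Set.mem_preimage, Set.mem_Iio, div_lt_iff₀ hmp] at hω
  have := (blockMax_le_iff hm 0 ω _).1 hω.le 0 hm
  simpa using this

end

/-! ### Independence and the Fréchet law -/

theorem lemma5 {Ω Ω' : Type*} [MeasurableSpace Ω] [MeasurableSpace Ω']
    (P : Measure Ω) [IsProbabilityMeasure P] (Q : Measure Ω') [IsProbabilityMeasure Q]
    (X : ℤ → Ω → ℝ) (hX : ∀ k, Measurable (X k))
    (Z : ℕ → Ω' → ℝ) (hZ : ∀ k, Measurable (Z k))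
    (α σ₀ : ℝ) (hα : 0 < α) (hσ₀ : 0 < σ₀)
    (hstat : IsStrictlyStationary X P)
    (htail : ∀ k, IsHeavyTailed α σ₀ (X k) P)
    (hconv : TendstoFDD (fun m k ω => blockMax X m k ω / (m : ℝ) ^ (1 / α)) Z P Q)
    (hms : IsMaxStableProcess Z Q) :
    iIndepFun Z Q ∧
      (∀ k l : ℕ, IdentDistrib (Z k) (Z l) Q Q) ∧
      ((∀ k : ℕ, ∀ᵐ ω ∂Q, Z k ω = 0) ∨
        ∃ σ : ℝ, 0 < σ ∧ ∀ k : ℕ, IsFrechet α σ (Z k) Q) := by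
  have hid : ∀ k, IdentDistrib (Z k) (Z 0) Q Q :=
    identDistrib_of_tendstoFDD_blockMax hZ hstat hconv
  set F : ℝ → ℝ := fun x => Q.real {ω | Z 0 ω ≤ x} with hF
  have hFk : ∀ k x, Q.real {ω | Z k ω ≤ x} = F x := fun k x =>
    congrArg ENNReal.toReal ((hid k).measure_mem_eq measurableSet_Iic)
  have hm : ∀ k x, MeasurableSet {ω | Z k ω ≤ x} := fun k x =>
    measurableSet_le (hZ k) measurable_const
  have hmono : Monotone F := fun x y hxy => measureReal_mono fun ω hω => le_trans hω hxy
  have h0 : ∀ x, 0 ≤ F x := fun x => measureReal_nonneg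
  have hlaw : IsProbabilityMeasure (Q.map (Z 0)) :=
    Measure.isProbabilityMeasure_map (hZ 0).aemeasurable
  have hcdf : ⇑(cdf (Q.map (Z 0))) = F := by
    ext x
    rw [cdf_eq_real, map_measureReal_apply (hZ 0) measurableSet_Iic]
    rfl
  have hlim : Tendsto F atTop (𝓝 1) := hcdf ▸ tendsto_cdf_atTop (Q.map (Z 0))
  have hright : Tendsto F (𝓝[≥] 0) (𝓝 (F 0)) := hcdf ▸ (cdf (Q.map (Z 0))).right_continuous 0
  have hneg : ∀ x < 0, F x = 0 := fun x hx => by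
    refine le_antisymm ?_ (h0 x)
    rw [← measureReal_neg_of_tendstoFDD_blockMax hX hα hconv (show x / 2 < 0 by linarith)]
    exact measureReal_mono fun ω (hω : Z 0 ω ≤ x) => show Z 0 ω < x / 2 by linarith
  have htl : ∀ x, 0 < x → 1 - F x ≤ σ₀ ^ α * x ^ (-α) := fun x hx => by
    refine le_trans (le_of_eq ?_)
      (measureReal_lt_of_tendstoFDD_blockMax hα hstat htail hσ₀ hconv hx)
    rw [hF, ← probReal_compl_eq_one_sub (hm 0 x)]
    congr 1; ext; simp
  have hself : ∀ n : ℕ, 1 ≤ n → ∀ x,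
      Q.real {ω | ∀ i ∈ Finset.range n, Z i ω ≤ (n : ℝ) ^ (1 / α) * x} = F x := fun n hn x =>
    measureReal_forall_le_of_tendstoFDD_blockMax hZ hconv hn x
  have hassoc : ∀ n : ℕ, 1 ≤ n → ∀ x, F ((n : ℝ) ^ (1 / α) * x) ^ n ≤ F x := by
    intro n hn x
    have := (hms (Finset.range n)).prod_le (Y := fun (k : Finset.range n) => Z k) (fun k => hZ k)
      (x := fun _ => (n : ℝ) ^ (1 / α) * x)
    simp only [hFk, Finset.prod_const, Finset.card_univ, Fintype.card_coe, Finset.card_range,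
      Subtype.forall] at this
    rwa [hself n hn] at this
  have hmax : ∀ n : ℕ, 1 ≤ n → ∃ a b : ℝ, 0 < a ∧ ∀ x, F (a * x + b) ^ n = F x := by
    intro n hn
    obtain ⟨a, b, ha, hab⟩ := (hms {0}).exists_norming
      (Y := fun (k : ({0} : Finset ℕ)) => Z k) (fun k => hZ k) hn
    let i₀ : ({0} : Finset ℕ) := ⟨0, Finset.mem_singleton_self 0⟩
    refine ⟨a i₀, b i₀, ha i₀, fun x => ?_⟩
    have := hab {i₀} (fun _ => x)
    simpa only [Set.mem_singleton_iff, forall_eq] using this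
  -- a value `F y = 1` spreads to all positive arguments by `hassoc`
  have hdich : (∀ x, F x < 1) ∨ ∀ x, 0 ≤ x → F x = 1 := by
    by_contra! hcon
    obtain ⟨⟨y, hy⟩, x, hx, hx1⟩ := hcon
    have hpos : ∀ z, 0 < z → F z = 1 := by
      intro z hz
      refine le_antisymm measureReal_le_one ?_
      have hT : Tendsto (fun n : ℕ => (n : ℝ) ^ (1 / α) * z) atTop atTop :=
        ((tendsto_rpow_atTop (by positivity)).comp
          tendsto_natCast_atTop_atTop).atTop_mul_const hz
      obtain ⟨n, hn, hn1⟩ := ((hT.eventually_ge_atTop y).and (eventually_ge_atTop 1)).exists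
      exact (one_le_pow₀ (hy.trans (hmono hn))).trans (hassoc n hn1 z)
    rcases hx.lt_or_eq with hx | rfl
    · exact hx1 (hpos x hx)
    · refine hx1 (tendsto_nhds_unique (hright.mono_left (nhdsWithin_mono _ Set.Ioi_subset_Ici_self))
        (tendsto_const_nhds.congr' ?_))
      filter_upwards [self_mem_nhdsWithin] with z hz
      exact (hpos z hz).symm
  have hscale : ∀ n : ℕ, 1 ≤ n → ∀ x, F ((n : ℝ) ^ (1 / α) * x) ^ n = F x := by
    rcases hdich with h | h
    · exact scaling_of_norming hα hmono h0 hlim hneg h htl hassoc hmax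
    · intro n hn x
      have hnp : 0 < (n : ℝ) ^ (1 / α) := Real.rpow_pos_of_pos (by exact_mod_cast hn) _
      rcases lt_or_ge x 0 with hx | hx
      · rw [hneg x hx, hneg _ (mul_neg_of_pos_of_neg hnp hx), zero_pow (by omega)]
      · rw [h x hx, h _ (by positivity), one_pow]
  have hrange : ∀ (n : ℕ) (x : ℕ → ℝ), 1 ≤ n →
      Q.real {ω | ∀ i ∈ Finset.range n, Z i ω ≤ x i} = ∏ i ∈ Finset.range n, F (x i) := by
    intro n x hn
    have hnp : 0 < (n : ℝ) ^ (1 / α) := Real.rpow_pos_of_pos (by exact_mod_cast hn) _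
    have := (hms (Finset.range n)).eq_prod_of_diagonal (Y := fun (k : Finset.range n) => Z k)
      (fun k => hZ k) ?_ ?_ (fun k => x k)
    · simp only [hFk, Subtype.forall] at this
      rw [this]
      exact Finset.prod_coe_sort (Finset.range n) (fun i => F (x i))
    · intro t
      have h1 := hself n hn (t / (n : ℝ) ^ (1 / α))
      have h2 := hscale n hn (t / (n : ℝ) ^ (1 / α))
      rw [mul_div_cancel₀ _ hnp.ne'] at h1 h2
      simp only [hFk, Finset.prod_const, Finset.card_univ, Fintype.card_coe, Finset.card_range,
        Subtype.forall]
      rw [h1, h2]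
    · intro i j t
      rw [hFk, hFk]
  refine ⟨iIndepFun_of_forall_le hZ fun I x => ?_, fun k l => (hid k).trans (hid l).symm, ?_⟩
  · refine le_antisymm ?_ ?_
    · obtain ⟨n, hn, hI⟩ : ∃ n : ℕ, 1 ≤ n ∧ I ⊆ Finset.range n :=
        ⟨I.sup id + 1, by omega, fun i hi => Finset.mem_range.2
          (Nat.lt_succ_of_le (Finset.le_sup (f := id) hi))⟩
      -- the coordinates outside `I` are controlled by a level `T → ∞`
      have hbound : ∀ T : ℝ, Q.real {ω | ∀ i ∈ I, Z i ω ≤ x i}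
          ≤ ∏ i ∈ Finset.range n, F (if i ∈ I then x i else T) + n * (1 - F T) := by
        intro T
        rw [← hrange n _ hn]
        have hU : Q.real (⋃ i ∈ Finset.range n, {ω | Z i ω ≤ T}ᶜ) ≤ n * (1 - F T) := by
          refine (measureReal_biUnion_finset_le _ _).trans (le_of_eq ?_)
          simp only [probReal_compl_eq_one_sub (hm _ T), hFk, Finset.sum_const, Finset.card_range,
            nsmul_eq_mul]
        refine le_trans ((measureReal_mono fun ω hω => ?_).trans (measureReal_union_le _ _))
          (add_le_add_right hU _)
        by_cases hT : ∀ i ∈ Finset.range n, Z i ω ≤ T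
        · refine Or.inl fun i hi => ?_
          split_ifs with h
          · exact hω i h
          · exact hT i hi
        · push Not at hT
          obtain ⟨i, hi, h⟩ := hT
          exact Or.inr (Set.mem_biUnion (Finset.mem_coe.2 hi) (not_le.2 h))
      have hTlim : Tendsto (fun T : ℝ => ∏ i ∈ Finset.range n, F (if i ∈ I then x i else T)
          + n * (1 - F T)) atTop
          (𝓝 (∏ i ∈ Finset.range n, (if i ∈ I then F (x i) else 1) + n * (1 - 1))) := by
        refine (tendsto_finsetProd _ fun i _ => ?_).add ((hlim.const_sub 1).const_mul _)
        split_ifs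
        · exact tendsto_const_nhds
        · exact hlim
      have := ge_of_tendsto' hTlim hbound
      rw [sub_self, mul_zero, add_zero, Finset.prod_ite_mem, Finset.inter_eq_right.2 hI] at this
      simpa only [hFk] using this
    · have := (hms I).prod_le (Y := fun (k : I) => Z k) (fun k => hZ k) (x := fun k => x k)
      rw [Finset.prod_coe_sort I (fun i => Q.real {ω | Z i ω ≤ x i})] at this
      simpa only [Subtype.forall] using this
  · rcases hdich with h | h
    · obtain ⟨σ, hσ, hσF⟩ := eq_frechet_of_scaling hα hmono hlim hneg h hscale
      exact Or.inr ⟨σ, hσ, fun k x => (hFk k x).trans (hσF x)⟩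
    · refine Or.inl fun k => ?_
      have h1 : ∀ᵐ ω ∂Q, Z k ω ≤ 0 := by
        have := (hFk k 0).trans (h 0 le_rfl)
        rw [ae_iff, ← measureReal_eq_zero_iff]
        have hc := probReal_compl_eq_one_sub (μ := Q) (hm k 0)
        rw [this, sub_self] at hc
        exact hc
      have h2 : ∀ᵐ ω ∂Q, ∀ j : ℕ, ¬ Z k ω ≤ -(1 / ((j : ℝ) + 1)) := by
        refine ae_all_iff.2 fun j => ?_
        rw [ae_iff, ← measureReal_eq_zero_iff]
        simp only [not_not]
        rw [hFk]
        exact hneg _ (neg_lt_zero.2 (by positivity))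
      filter_upwards [h1, h2] with ω hω1 hω2
      refine le_antisymm hω1 (not_lt.1 fun hlt => ?_)
      obtain ⟨j, hj⟩ := exists_nat_one_div_lt (neg_pos.2 hlt)
      exact hω2 j (by linarith)
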